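/- **Theorem.** Let $\mu>0$, $\beta\ge 0$, $\eta=\beta/\mu$. Let $Y_1,Y_2,\dots$ be exponential with rate $\mu$, let $s_1,s_2,\dots$ be uniform on $\{1,-1\}$, all independent. For $x\ge 0$ (the depth of the first scattering of a beam in a one-sided medium with dissipation factor $\beta$) put $$T_x=\min\Big\{T\ge 0:\ x+\sum_{i=1}^{T}s_iY_i<0\Big\},\qquad Z_x=-x-\sum_{i=1}^{T_x}s_iY_i,\qquad L_x=\sum_{i=1}^{T_x}Y_i .$$ Let $\alpha=\mathbb E\,e^{-2\beta Y_1}$. For a random depth $x\ge 0$, independent of the walk, with mean $\bar x>0$, and for $\varepsilon>0$ let $$\hat\rho_\varepsilon=\mathbb E_x\big(e^{-\beta x}\,\mathbb E\,\alpha^{T_x}\big)\,\big(1-\beta\,\Delta_\varepsilon\big),\qquad \Delta_\varepsilon=\frac{\mathbb E\,e^{-2\varepsilon Z_x/\bar x}-\mathbb E\,e^{-\varepsilon Z_x/\bar x}}{\varepsilon/\bar x},$$ where the expectations in $\Delta_\varepsilon$ are over $x$ and the walk. The delta-method estimate $\hat\rho$ of the reflected fraction is $\lim_{\varepsilon\to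 0^+}\hat\rho_\varepsilon$. For normal incidence $x$ is exponential with rate $\mu$; for incidence at angle $\theta$, $-\pi/2<\theta<\pi/2$, $x$ is $\cos\theta$ times such a variable. For normal incidence the reflected fraction and its Cauchy–Schwarz upper bound are $$\rho=\mathbb E_x\big(e^{-\beta x}\,\mathbb E\,e^{-\beta L_x+\beta|Z_x|}\big),\qquad \rho^u=\mathbb E_x\Big(e^{-\beta x}\sqrt{\mathbb E\,\alpha^{T_x}\;\mathbb E\,e^{2\beta|Z_x|}}\Big).$$ Then the following hold. 1. For every $x\ge 0$, $T_x<\infty$ almost surely, and the expectations defining $\rho$ are finite. 2. For normal incidence the limit $\hat\rho$ exists and $$\hat\rho=\frac{1-\sqrt{\frac{2\eta}{2\eta+1}}}{\eta+1+\sqrt{\frac{2\eta}{2\eta+1}}}\,(1+\eta).$$ 3. For every incident angle $\theta$ with $-\pi/2<\theta<\pi/2$ the limit $\hat\rho$ exists and $$\hat\rho=\Big(1-\sqrt{\tfrac{2\eta}{1+2\eta}}\Big)\Big(1+\Big(\eta+\sqrt{\tfrac{2\eta}{1+2\eta}}\Big)\cos\theta\Big)^{-1}(1+\eta).$$ 4.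 If $\mu>2\beta$, then the expectations defining $\rho^u$ are finite and $$\rho\le\rho^u=\frac{\Big(1-\sqrt{\frac{2\eta}{1+2\eta}}\Big)^{1/2}\Big(\frac1{1-2\eta}\Big)^{1/2}}{1+\eta+\frac12\sqrt{\frac{2\eta}{1+2\eta}}}.$$ -/

import Mathlib

open MeasureTheory ProbabilityTheory Filter Topology

noncomputable section

namespace PorousMedium

/-- `s i` and `Y i` are the side and the length of the `(i+1)`-st step of a one-sided renewal
process on the probability space `(Ω, P)`: the steps are independent and identically distributed,
a step goes to the right (`s i = 1`) with probability `p` and to the left (`s i = -1`) with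
probability `1 - p`, and independently of this its length has the law `ν`. -/
structure IsRenewalSteps {Ω : Type*} [MeasurableSpace Ω] (P : Measure Ω) (p : ℝ) (ν : Measure ℝ)
    (s Y : ℕ → Ω → ℝ) : Prop where
  measurable_side : ∀ i, Measurable (s i)
  measurable_length : ∀ i, Measurable (Y i)
  prob_right : ∀ i, P {ω | s i ω = 1} = ENNReal.ofReal p
  prob_left : ∀ i, P {ω | s i ω = -1} = ENNReal.ofReal (1 - p)
  law_length : ∀ i, P.map (Y i) = ν
  indep_side_length : ∀ i, IndepFun (s i) (Y i) P
  indep_steps : iIndepFun (fun i ω => (s i ω, Y i ω)) P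

section Walk

variable {Ω : Type*} (s Y : ℕ → Ω → ℝ)

/-- Depth after `n` steps of the walk that starts at depth `x`. -/
def position (x : ℝ) (n : ℕ) (ω : Ω) : ℝ := x + ∑ i ∈ Finset.range n, s i ω * Y i ω

/-- The event that the walk started at depth `x` leaves the medium (becomes negative). -/
def exits (x : ℝ) : Set Ω := {ω | ∃ n, position s Y x n ω < 0}

/-- The exit time `T_x`, meaningful on the event `exits s Y x`. -/
def exitTime (x : ℝ) (ω : Ω) : ℕ := sInf {n | position s Y x n ω < 0}

/-- The overshoot `Z_x = -∑_{i ≤ T_x} s_i Y_i - x`, meaningful on the event `exits s Y x`. -/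
def overshoot (x : ℝ) (ω : Ω) : ℝ :=
  -(∑ i ∈ Finset.range (exitTime s Y x ω), s i ω * Y i ω) - x

/-- The total travel `L_x = ∑_{i ≤ T_x} Y_i`, meaningful on the event `exits s Y x`. -/
def travel (x : ℝ) (ω : Ω) : ℝ := ∑ i ∈ Finset.range (exitTime s Y x ω), Y i ω

end Walk

section Reflection

variable {Ω : Type*} [MeasurableSpace Ω] (P : Measure Ω) (s Y : ℕ → Ω → ℝ)

/-- The law of the depth `x cos θ` of the first scattering for a beam incident at angle `θ`, where
the distance `x` to the first scattering has the law `ν`. -/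
def depthLaw (ν : Measure ℝ) (θ : ℝ) : Measure ℝ := ν.map (fun x => x * Real.cos θ)

/-- `𝔼 exp (-v Y)` for a length `Y` of law `ν`. -/
def laplace (ν : Measure ℝ) (v : ℝ) : ℝ := ∫ y, Real.exp (-v * y) ∂ν

/-- `𝔼 α ^ T_x` (a walk that never exits contributes `0`). -/
def exitTimeGF (x α : ℝ) : ℝ := ∫ ω in exits s Y x, α ^ exitTime s Y x ω ∂P

/-- `𝔼 exp (v |Z_x|)`, over the walks that exit. -/
def overshootMGF (x v : ℝ) : ℝ := ∫ ω in exits s Y x, Real.exp (v * |overshoot s Y x ω|) ∂P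

/-- The expected power that leaves the medium from a beam of unit power scattered at depth `x`.
By Beer's law the power decays exponentially, with rate `β`, along the path inside the medium, whose
length is the total travel less the overshoot; a beam that never exits is absorbed. -/
def reflectedFrom (β x : ℝ) : ℝ :=
  ∫ ω in exits s Y x, Real.exp (-β * travel s Y x ω + β * |overshoot s Y x ω|) ∂P

/-- The reflected fraction `ρ`, where the first scattering depth has the law `D`. -/
def reflectedFraction (D : Measure ℝ) (β : ℝ) : ℝ :=
  ∫ x, Real.exp (-β * x) * reflectedFrom P s Y β x ∂D

/-- The Cauchy-Schwarz upper bound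
`ρᵘ = 𝔼_x (exp (-β x) √(𝔼 α ^ T_x · 𝔼 exp (2 β |Z_x|)))` with `α = 𝔼 exp (-2 β Y)`, where the
beam length has the law `ν` and the first scattering depth has the law `D`. -/
def upperBound (ν D : Measure ℝ) (β : ℝ) : ℝ :=
  ∫ x, Real.exp (-β * x) *
    √(exitTimeGF P s Y x (laplace ν (2 * β)) * overshootMGF P s Y x (2 * β)) ∂D

/-- `Δ_ε 𝔼 exp (-ε Z_x / x̄)`: the forward difference quotient of `ζ ↦ 𝔼 exp (-ζ Z_x)` between
`ε / x̄` and `2 ε / x̄`, where `x` has the law `D` and mean `x̄`. As `ε` tends to `0` it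
approximates `-𝔼 Z_x`. -/
def overshootDiff (D : Measure ℝ) (ε : ℝ) : ℝ :=
  ((∫ x, ∫ ω in exits s Y x,
        Real.exp (-(2 * ε / (∫ t, t ∂D)) * overshoot s Y x ω) ∂P ∂D)
    - ∫ x, ∫ ω in exits s Y x,
        Real.exp (-(ε / (∫ t, t ∂D)) * overshoot s Y x ω) ∂P ∂D)
    / (ε / (∫ t, t ∂D))

/-- The delta-method estimate with increment `ε`,
`𝔼_x (exp (-β x) 𝔼 α ^ T_x) · (1 - Δ_ε 𝔼 exp (-ε Z_x / x̄) · β)` with `α = 𝔼 exp (-2 β Y)`, where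
the beam length has the law `ν` and the first scattering depth has the law `D`. -/
def deltaEstimate (ν D : Measure ℝ) (β ε : ℝ) : ℝ :=
  (∫ x, Real.exp (-β * x) * exitTimeGF P s Y x (laplace ν (2 * β)) ∂D)
    * (1 - overshootDiff P s Y D ε * β)

end Reflection

end PorousMedium

end

noncomputable section

namespace PorousMedium

open Set

/-! Everything follows from one joint transform: for the exponential walk started at `x ≥ 0`, `𝔼 a ^
T exp (-v L + w Z) = C exp (-c x)`, where `l = μ + v`, `c ^ 2 = l ^ 2 - l a μ` and `C = (l - c) / (l
- w)`. The reason is that `exitHarmonic`, with these constants, has the mean value property under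
one step weighted by `a exp (-v Y)` (`exitHarmonic_mean_value`): the quadratic equation matches the
coefficient of `exp (-c S)`, and the value of `C` cancels the terms in `exp (-l S)`. The weighted
values along the path therefore form a martingale. Stopping it at the exit splits its initial value
into the contributions of the exit times and a remainder carried by the surviving walks, at most `C
a ^ n P(survival up to n)`.

For `a < 1` the remainder decays geometrically. Taking `v = w = 0` and letting `a` increase to `1`
shows that the walk exits almost surely; hence survival probabilities tend to `0`, and the formula
extends to `a = 1` (`setLIntegral_exitWeight`).

The rest is specialization. With `a = 1`, `v = 0` one gets `c = 0`: the overshoot is exponential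
with rate `μ` whatever `x` is, so the difference quotient tends to `-1/μ` and produces the factor `1
+ η`. With `v = w = 0` one gets the transform of the exit time, which is averaged over the depth.
The upper bound is Cauchy-Schwarz applied to `exp (-β L) * exp (β Z)`, together with `𝔼 exp (-2 β L)
≤ 𝔼 α ^ T`, read off from the two explicit formulas. -/

/-! ### Integrals against the exponential law. -/

lemma lintegral_exp_Ioi {k : ℝ} (hk : 0 < k) (S : ℝ) :
    ∫⁻ y in Ioi S, ENNReal.ofReal (Real.exp (-(k * y))) =
      ENNReal.ofReal (Real.exp (-(k * S)) / k) := by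
  have h1 := integrableOn_exp_mul_Ioi (neg_lt_zero.2 hk) S
  have h2 := integral_exp_mul_Ioi (neg_lt_zero.2 hk) S
  simp only [neg_mul] at h1 h2
  rw [← ofReal_integral_eq_lintegral_ofReal h1 (ae_of_all _ fun _ => (Real.exp_pos _).le), h2,
    neg_div_neg_eq]

lemma lintegral_exp_Ioc {k S : ℝ} (hk : 0 < k) (hS : 0 ≤ S) :
    ∫⁻ y in Ioc 0 S, ENNReal.ofReal (Real.exp (-(k * y))) =
      ENNReal.ofReal ((1 - Real.exp (-(k * S))) / k) := by
  have h := lintegral_union (μ := volume)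
    (f := fun y => ENNReal.ofReal (Real.exp (-(k * y)))) (measurableSet_Ioi (a := S))
    (Set.disjoint_left.2 fun y (hy : y ∈ Ioc 0 S) (hy' : y ∈ Ioi S) => not_lt.2 hy.2 hy')
  rw [Ioc_union_Ioi_eq_Ioi hS, lintegral_exp_Ioi hk, lintegral_exp_Ioi hk] at h
  have h3 := ENNReal.eq_sub_of_add_eq ENNReal.ofReal_ne_top h.symm
  rw [h3, ← ENNReal.ofReal_sub _ (by positivity)]
  congr 1
  simp [sub_div]

lemma lintegral_expMeasure (μ : ℝ) {f : ℝ → ENNReal} (hf : Measurable f) :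
    ∫⁻ y, f y ∂(expMeasure μ) =
      ∫⁻ y in Ioi 0, ENNReal.ofReal (μ * Real.exp (-(μ * y))) * f y := by
  have hm : Measurable (exponentialPDF μ) := (measurable_exponentialPDFReal μ).ennreal_ofReal
  change ∫⁻ y, f y ∂(volume.withDensity (exponentialPDF μ)) = _
  rw [lintegral_withDensity_eq_lintegral_mul _ hm hf, setLIntegral_congr Ioi_ae_eq_Ici,
    ← lintegral_indicator measurableSet_Ici]
  refine lintegral_congr fun y => ?_
  by_cases hy : 0 ≤ y
  · simp [indicator_of_mem (mem_Ici.2 hy), exponentialPDF_of_nonneg hy]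
  · rw [indicator_of_notMem (by simpa using hy)]
    simp [exponentialPDF_of_neg (not_le.1 hy)]

lemma ae_expMeasure_pos (μ : ℝ) : ∀ᵐ y ∂(expMeasure μ), 0 < y := by
  have h := lintegral_expMeasure μ (f := (Iic (0 : ℝ)).indicator 1)
    (measurable_one.indicator measurableSet_Iic)
  rw [lintegral_indicator_one measurableSet_Iic] at h
  rw [ae_iff]
  simp only [not_lt]
  change expMeasure μ (Iic 0) = 0
  rw [h, setLIntegral_congr_fun (g := fun _ => 0) measurableSet_Ioi, lintegral_zero]
  intro y hy
  simp [hy.out]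

/-! ### The harmonic function of the weighted walk. -/

/-- The function that equals `exp (-w y)` outside the medium and `C exp (-c y)` inside. For suitable
`C` and `c` it is harmonic inside for the exponentially killed walk. -/
def exitHarmonic (C c w y : ℝ) : ℝ :=
  if y < 0 then Real.exp (-(w * y)) else C * Real.exp (-(c * y))

lemma measurable_exitHarmonic (C c w : ℝ) : Measurable (exitHarmonic C c w) :=
  Measurable.ite measurableSet_Iio (by fun_prop) (by fun_prop)

/-- Mean value property of `exitHarmonic` under one step of the walk. -/
lemma exitHarmonic_mean_value {μ a v w c S : ℝ} (hμ : 0 < μ) (ha : 0 ≤ a) (hw : w < μ + v)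
    (hc : 0 ≤ c) (hcl : c < μ + v) (hcc : c ^ 2 = (μ + v) ^ 2 - (μ + v) * (a * μ)) (hS : 0 ≤ S) :
    2⁻¹ * ∫⁻ y, ENNReal.ofReal (a * Real.exp (-(v * y))) * ENNReal.ofReal
          (exitHarmonic ((μ + v - c) / (μ + v - w)) c w (S + y)) ∂(expMeasure μ) +
      2⁻¹ * ∫⁻ y, ENNReal.ofReal (a * Real.exp (-(v * y))) * ENNReal.ofReal
          (exitHarmonic ((μ + v - c) / (μ + v - w)) c w (S - y)) ∂(expMeasure μ) =
      ENNReal.ofReal ((μ + v - c) / (μ + v - w) * Real.exp (-(c * S))) := by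
  have hH := measurable_exitHarmonic ((μ + v - c) / (μ + v - w)) c w
  rw [lintegral_expMeasure μ (by fun_prop), lintegral_expMeasure μ (by fun_prop)]
  -- `l` is the decay rate of the step density multiplied by the weight `exp (-v y)`.
  obtain ⟨l, rfl⟩ : ∃ l, v = l - μ := ⟨μ + v, by ring⟩
  simp only [add_sub_cancel] at *
  set C := (l - c) / (l - w) with hC
  have hC0 : 0 < C := div_pos (by linarith) (by linarith)
  have e1 : ∫⁻ y in Ioi 0, ENNReal.ofReal (μ * Real.exp (-(μ * y))) *
      (ENNReal.ofReal (a * Real.exp (-((l - μ) * y))) *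
        ENNReal.ofReal (exitHarmonic C c w (S + y))) =
      ENNReal.ofReal (μ * a * C * Real.exp (-(c * S)) / (l + c)) := by
    rw [setLIntegral_congr_fun (g := fun y => ENNReal.ofReal (μ * a * C * Real.exp (-(c * S))) *
      ENNReal.ofReal (Real.exp (-((l + c) * y)))) measurableSet_Ioi,
      lintegral_const_mul _ (by fun_prop), lintegral_exp_Ioi (by linarith),
      ← ENNReal.ofReal_mul (by positivity)]
    · simp [div_eq_mul_inv]
    · intro y hy
      have hy' : ¬ S + y < 0 := by have := hy.out; linarith
      simp only [exitHarmonic, if_neg hy']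
      rw [← ENNReal.ofReal_mul (by positivity), ← ENNReal.ofReal_mul (by positivity),
        ← ENNReal.ofReal_mul (by positivity)]
      congr 1
      rw [show -(c * (S + y)) = -(c * S) + (-(c * y)) by ring,
        show -((l + c) * y) = -(μ * y) + -((l - μ) * y) + -(c * y) by ring]
      simp only [Real.exp_add]
      ring
  have e2 : ∫⁻ y in Ioi 0, ENNReal.ofReal (μ * Real.exp (-(μ * y))) *
      (ENNReal.ofReal (a * Real.exp (-((l - μ) * y))) *
        ENNReal.ofReal (exitHarmonic C c w (S - y))) =
      ENNReal.ofReal (μ * a * C * Real.exp (-(c * S)) * ((1 - Real.exp (-((l - c) * S))) / (l - c)))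
       + ENNReal.ofReal (μ * a * Real.exp (-(w * S)) * (Real.exp (-((l - w) * S)) / (l - w))) := by
    -- A step to the left stays inside the medium exactly when its length is at most `S`.
    rw [← Ioc_union_Ioi_eq_Ioi hS, lintegral_union measurableSet_Ioi
      (Set.disjoint_left.2 fun y (hy : y ∈ Ioc 0 S) (hy' : y ∈ Ioi S) => not_lt.2 hy.2 hy')]
    congr 1
    · rw [setLIntegral_congr_fun (g := fun y => ENNReal.ofReal (μ * a * C * Real.exp (-(c * S))) *
        ENNReal.ofReal (Real.exp (-((l - c) * y)))) measurableSet_Ioc,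
        lintegral_const_mul _ (by fun_prop), lintegral_exp_Ioc (by linarith) hS,
        ← ENNReal.ofReal_mul (by positivity)]
      intro y hy
      have hy' : ¬ S - y < 0 := by have := hy.2; linarith
      simp only [exitHarmonic, if_neg hy']
      rw [← ENNReal.ofReal_mul (by positivity), ← ENNReal.ofReal_mul (by positivity),
        ← ENNReal.ofReal_mul (by positivity)]
      congr 1
      rw [show -(c * (S - y)) = -(c * S) + c * y by ring,
        show -((l - c) * y) = -(μ * y) + -((l - μ) * y) + c * y by ring]
      simp only [Real.exp_add]
      ring
    · rw [setLIntegral_congr_fun (g := fun y => ENNReal.ofReal (μ * a * Real.exp (-(w * S))) *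
        ENNReal.ofReal (Real.exp (-((l - w) * y)))) measurableSet_Ioi,
        lintegral_const_mul _ (by fun_prop), lintegral_exp_Ioi (by linarith) S,
        ← ENNReal.ofReal_mul (by positivity)]
      intro y hy
      have hy' : S - y < 0 := by have := hy.out; linarith
      simp only [exitHarmonic, if_pos hy']
      rw [← ENNReal.ofReal_mul (by positivity), ← ENNReal.ofReal_mul (by positivity),
        ← ENNReal.ofReal_mul (by positivity)]
      congr 1
      rw [show -(w * (S - y)) = -(w * S) + w * y by ring,
        show -((l - w) * y) = -(μ * y) + -((l - μ) * y) + w * y by ring]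
      simp only [Real.exp_add]
      ring
  have hlc : 0 < l - c := by linarith
  have hlw : 0 < l - w := by linarith
  have hlp : 0 < l + c := by linarith
  have hle : Real.exp (-((l - c) * S)) ≤ 1 := Real.exp_le_one_iff.2 (by nlinarith)
  have hq : 0 ≤ (1 - Real.exp (-((l - c) * S))) / (l - c) := div_nonneg (by linarith) hlc.le
  rw [e1, e2, ← mul_add, ← ENNReal.ofReal_add (by positivity) (by positivity),
    ← ENNReal.ofReal_add (by positivity) (by positivity)]
  rw [show (2⁻¹ : ENNReal) = ENNReal.ofReal 2⁻¹ by
    rw [ENNReal.ofReal_inv_of_pos two_pos]; simp, ← ENNReal.ofReal_mul (by norm_num)]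
  congr 1
  have x1 : Real.exp (-(w * S)) * Real.exp (-((l - w) * S)) = Real.exp (-(l * S)) := by
    rw [← Real.exp_add]; ring_nf
  have x2 : Real.exp (-(c * S)) * Real.exp (-((l - c) * S)) = Real.exp (-(l * S)) := by
    rw [← Real.exp_add]; ring_nf
  -- This is what fixes `C`: the two terms in `exp (-l S)` cancel.
  have hCd : C / (l - c) = 1 / (l - w) := by rw [hC]; field_simp
  have hl : l ≠ 0 := by intro h; subst h; linarith
  -- The quadratic `hcc`, that is `(l + c) * (l - c) = l * (a * μ)`, in partial fractions.
  have key : μ * a * (1 / (l + c) + 1 / (l - c)) = 2 := by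
    field_simp
    have : l * (μ * a * 2) = l * ((l + c) * (l - c)) * 2 / l * 1 := by
      field_simp; nlinarith
    field_simp at this
    nlinarith
  calc 2⁻¹ * (μ * a * C * Real.exp (-(c * S)) / (l + c) +
        (μ * a * C * Real.exp (-(c * S)) * ((1 - Real.exp (-((l - c) * S))) / (l - c)) +
        μ * a * Real.exp (-(w * S)) * (Real.exp (-((l - w) * S)) / (l - w))))
      = 2⁻¹ * (C * Real.exp (-(c * S)) * (μ * a * (1 / (l + c) + 1 / (l - c)))
        - μ * a * (C / (l - c)) * (Real.exp (-(c * S)) * Real.exp (-((l - c) * S)))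
        + μ * a * (1 / (l - w)) * (Real.exp (-(w * S)) * Real.exp (-((l - w) * S)))) := by ring
    _ = C * Real.exp (-(c * S)) := by rw [x1, x2, hCd, key]; ring

/-! ### Exit events and their measurability in the past. -/

/-- The events determined by the first `n` steps. -/
abbrev past {Ω : Type*} (s Y : ℕ → Ω → ℝ) (n : ℕ) : MeasurableSpace Ω :=
  ⨆ i ∈ Iio n, MeasurableSpace.comap (fun ω => (s i ω, Y i ω)) inferInstance

/-- The event that the walk started at `x` is inside the medium at all times up to `n`. -/
def survives {Ω : Type*} (s Y : ℕ → Ω → ℝ) (x : ℝ) (n : ℕ) : Set Ω :=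
  {ω | ∀ k ≤ n, 0 ≤ position s Y x k ω}

/-- The event that the walk started at `x` leaves the medium at time `n + 1`. -/
def exitsAt {Ω : Type*} (s Y : ℕ → Ω → ℝ) (x : ℝ) (n : ℕ) : Set Ω :=
  survives s Y x n ∩ {ω | position s Y x (n + 1) ω < 0}

/-- The weight `a ^ n exp (-v ∑_{i < n} Y_i)` of the first `n` steps. -/
def pathWeight {Ω : Type*} (Y : ℕ → Ω → ℝ) (a v : ℝ) (n : ℕ) (ω : Ω) : ℝ :=
  a ^ n * Real.exp (-(v * ∑ i ∈ Finset.range n, Y i ω))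

section Paths

variable {Ω : Type*} {s Y : ℕ → Ω → ℝ}

lemma position_succ (x : ℝ) (n : ℕ) (ω : Ω) :
    position s Y x (n + 1) ω = position s Y x n ω + s n ω * Y n ω := by
  simp [position, Finset.sum_range_succ, add_assoc]

lemma pathWeight_succ (a v : ℝ) (n : ℕ) (ω : Ω) :
    pathWeight Y a v (n + 1) ω = pathWeight Y a v n ω * (a * Real.exp (-(v * Y n ω))) := by
  simp only [pathWeight, Finset.sum_range_succ, pow_succ, mul_add, neg_add, Real.exp_add]
  ring

lemma pathWeight_nonneg {a : ℝ} (ha : 0 ≤ a) (v : ℝ) (n : ℕ) (ω : Ω) :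
    0 ≤ pathWeight Y a v n ω := by
  unfold pathWeight; positivity

lemma survives_succ (x : ℝ) (n : ℕ) :
    survives s Y x (n + 1) = survives s Y x n ∩ {ω | position s Y x (n + 1) ω < 0}ᶜ := by
  ext ω
  simp only [survives, mem_ofPred_eq, mem_inter_iff, mem_compl_iff, not_lt]
  constructor
  · exact fun h => ⟨fun k hk => h k (by omega), h _ le_rfl⟩
  · rintro ⟨h1, h2⟩ k hk
    rcases Nat.lt_or_ge k (n + 1) with h | h
    · exact h1 k (by omega)
    · rwa [le_antisymm hk h]

lemma measurable_step_past {i n : ℕ} (hi : i < n) :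
    Measurable[past s Y n] (fun ω => (s i ω, Y i ω)) :=
  (comap_measurable _).mono (le_iSup₂_of_le (f := fun j (_ : j ∈ Iio n) =>
    MeasurableSpace.comap (fun ω => (s j ω, Y j ω)) inferInstance) i hi le_rfl) le_rfl

lemma measurable_position_past (x : ℝ) {k n : ℕ} (hk : k ≤ n) :
    Measurable[past s Y n] (position s Y x k) := by
  unfold position
  refine measurable_const.add (Finset.measurable_fun_sum _ fun i hi => ?_)
  have h := measurable_step_past (s := s) (Y := Y) (lt_of_lt_of_le (Finset.mem_range.1 hi) hk)
  exact h.fst.mul h.snd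

lemma measurable_pathWeight_past (a v : ℝ) (n : ℕ) :
    Measurable[past s Y n] (pathWeight Y a v n) := by
  unfold pathWeight
  refine measurable_const.mul (Real.measurable_exp.comp ?_)
  refine (measurable_const.mul (Finset.measurable_fun_sum _ fun i hi => ?_)).neg
  exact (measurable_step_past (s := s) (Y := Y) (Finset.mem_range.1 hi)).snd

lemma measurableSet_survives_past (x : ℝ) (n : ℕ) :
    MeasurableSet[past s Y n] (survives s Y x n) := by
  have : survives s Y x n = ⋂ k ∈ Iic n, {ω | 0 ≤ position s Y x k ω} := by
    ext ω; simp [survives]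
  rw [this]
  refine MeasurableSet.biInter (to_countable _) fun k hk => ?_
  exact (measurable_position_past x hk) measurableSet_Ici

lemma exits_eq_iUnion {x : ℝ} (hx : 0 ≤ x) : exits s Y x = ⋃ n, exitsAt s Y x n := by
  ext ω
  simp only [exits, mem_ofPred_eq, mem_iUnion, exitsAt, survives, mem_inter_iff]
  constructor
  · intro h
    classical
    -- The first exit index is not `0` because the start `x` is nonnegative; hence the shift by one
    -- in `exitsAt`.
    obtain ⟨n, hn⟩ : ∃ n, Nat.find h = n + 1 := Nat.exists_eq_succ_of_ne_zero fun h0 => by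
      have := Nat.find_spec h
      rw [h0] at this
      simp [position] at this
      linarith
    refine ⟨n, fun k hk => not_lt.1 (Nat.find_min h (by omega)), ?_⟩
    rw [← hn]
    exact Nat.find_spec h
  · rintro ⟨n, -, h⟩
    exact ⟨_, h⟩

lemma exitTime_of_mem {x : ℝ} {n : ℕ} {ω : Ω} (h : ω ∈ exitsAt s Y x n) :
    exitTime s Y x ω = n + 1 := by
  refine le_antisymm (Nat.sInf_le h.2) (le_csInf ⟨_, h.2⟩ fun k hk => ?_)
  by_contra hlt
  exact not_lt.2 (h.1 k (by omega)) hk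

lemma overshoot_of_mem {x : ℝ} {n : ℕ} {ω : Ω} (h : ω ∈ exitsAt s Y x n) :
    overshoot s Y x ω = -position s Y x (n + 1) ω := by
  rw [overshoot, exitTime_of_mem h, position]; ring

lemma pairwise_disjoint_exitsAt (x : ℝ) : Pairwise (Function.onFun Disjoint (exitsAt s Y x)) := by
  intro m n hmn
  refine disjoint_left.2 fun ω hm hn => hmn ?_
  have := exitTime_of_mem hm
  have := exitTime_of_mem hn
  omega

lemma overshoot_pos {x : ℝ} (hx : 0 ≤ x) {ω : Ω} (h : ω ∈ exits s Y x) :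
    0 < overshoot s Y x ω := by
  rw [exits_eq_iUnion hx] at h
  obtain ⟨n, hn⟩ := mem_iUnion.1 h
  rw [overshoot_of_mem hn]
  exact neg_pos.2 hn.2

/-! ### The law of one step and its independence of the past. -/

section Law

variable [MeasurableSpace Ω] {P : Measure Ω} {ν : Measure ℝ}

namespace IsRenewalSteps

lemma measurable_step {p : ℝ} (h : IsRenewalSteps P p ν s Y) (i : ℕ) :
    Measurable (fun ω => (s i ω, Y i ω)) :=
  (h.measurable_side i).prodMk (h.measurable_length i)

lemma past_le {p : ℝ} (h : IsRenewalSteps P p ν s Y) (n : ℕ) : past s Y n ≤ ‹MeasurableSpace Ω› :=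
  iSup₂_le fun i _ => (h.measurable_step i).comap_le

lemma indepFun_step {E : Type*} [MeasurableSpace E] {p : ℝ} (h : IsRenewalSteps P p ν s Y) (n : ℕ)
    {U : Ω → E} (hU : Measurable[past s Y n] U) :
    IndepFun U (fun ω => (s n ω, Y n ω)) P := by
  -- Step `n` has an index outside `Iio n`, so the blocks of steps are disjoint.
  have hi := indep_iSup_of_disjoint (fun i => (h.measurable_step i).comap_le) h.indep_steps
    (S := Iio n) (T := {n}) (by simp)
  rw [IndepFun_iff_Indep]
  refine indep_of_indep_of_le_right (indep_of_indep_of_le_left hi hU.comap_le) ?_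
  simp

variable [IsProbabilityMeasure P]

lemma map_side (h : IsRenewalSteps P (1 / 2) ν s Y) (i : ℕ) :
    P.map (s i) = (2⁻¹ : ENNReal) • Measure.dirac 1 + (2⁻¹ : ENNReal) • Measure.dirac (-1) := by
  have hhalf : ENNReal.ofReal (1 / 2) = 2⁻¹ := by
    rw [one_div, ENNReal.ofReal_inv_of_pos two_pos]; simp
  have hhalf' : ENNReal.ofReal (1 - 1 / 2) = 2⁻¹ := by
    rw [← hhalf]; norm_num
  have m1 : P.map (s i) {1} = 2⁻¹ := by
    rw [Measure.map_apply (h.measurable_side i) (measurableSet_singleton _), ← hhalf,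
      ← h.prob_right i]
    rfl
  have m2 : P.map (s i) {-1} = 2⁻¹ := by
    rw [Measure.map_apply (h.measurable_side i) (measurableSet_singleton _), ← hhalf',
      ← h.prob_left i]
    rfl
  have hpm := Measure.isProbabilityMeasure_map (μ := P) (h.measurable_side i).aemeasurable
  have hd : Disjoint ({1} : Set ℝ) {-1} := by
    rw [disjoint_singleton]; norm_num
  -- The two atoms already carry the full mass `1/2 + 1/2`.
  have hu : P.map (s i) ({1} ∪ {-1})ᶜ = 0 := by
    rw [prob_compl_eq_zero_iff (by measurability), measure_union hd (measurableSet_singleton _),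
      m1, m2, ENNReal.inv_two_add_inv_two]
  have hr : P.map (s i) = (P.map (s i)).restrict ({1} ∪ {-1}) :=
    (Measure.restrict_eq_self_of_ae_mem (by rw [ae_iff]; exact hu)).symm
  rw [hr, Measure.restrict_union hd (measurableSet_singleton _), Measure.restrict_singleton,
    Measure.restrict_singleton, m1, m2]

lemma lintegral_map_step [SFinite ν] (h : IsRenewalSteps P (1 / 2) ν s Y) (i : ℕ)
    {F : ℝ × ℝ → ENNReal} (hF : Measurable F) :
    ∫⁻ z, F z ∂(P.map fun ω => (s i ω, Y i ω)) =
      2⁻¹ * ∫⁻ y, F (1, y) ∂ν + 2⁻¹ * ∫⁻ y, F (-1, y) ∂ν := by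
  rw [(indepFun_iff_map_prod_eq_prod_map_map (h.measurable_side i).aemeasurable
    (h.measurable_length i).aemeasurable).1 (h.indep_side_length i), h.law_length i,
    lintegral_prod _ hF.aemeasurable, h.map_side i, lintegral_add_measure, lintegral_smul_measure,
    lintegral_smul_measure, lintegral_dirac, lintegral_dirac, smul_eq_mul, smul_eq_mul]

/-- Integration over the next step, given the past. -/
lemma lintegral_next [SFinite ν] {E : Type*} [MeasurableSpace E]
    (h : IsRenewalSteps P (1 / 2) ν s Y) (n : ℕ) {U : Ω → E} (hU : Measurable[past s Y n] U)
    {F : E → ℝ → ℝ → ENNReal} (hF : Measurable fun z : E × ℝ × ℝ => F z.1 z.2.1 z.2.2) :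
    ∫⁻ ω, F (U ω) (s n ω) (Y n ω) ∂P =
      ∫⁻ ω, (2⁻¹ * ∫⁻ y, F (U ω) 1 y ∂ν + 2⁻¹ * ∫⁻ y, F (U ω) (-1) y ∂ν) ∂P := by
  have hU' : Measurable U := hU.mono (h.past_le n) le_rfl
  have hs := h.measurable_step n
  have := Measure.isProbabilityMeasure_map (μ := P) hs.aemeasurable
  have h1 := lintegral_map (μ := P) hF (hU'.prodMk hs)
  rw [(indepFun_iff_map_prod_eq_prod_map_map hU'.aemeasurable hs.aemeasurable).1
    (h.indepFun_step n hU), lintegral_prod _ hF.aemeasurable,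
    lintegral_map (hF.lintegral_prod_right' ) hU'] at h1
  rw [← h1]
  refine lintegral_congr fun ω => ?_
  exact h.lintegral_map_step n (hF.comp measurable_prodMk_left)

end IsRenewalSteps

end Law

end Paths

/-! ### Optional stopping and the joint transform. -/

section ExitFunctional

variable {Ω : Type*} {s Y : ℕ → Ω → ℝ}

/-- The weight `a ^ T exp (-v L + w Z)` of a walk at its exit. -/
def exitWeight (s Y : ℕ → Ω → ℝ) (x a v w : ℝ) (ω : Ω) : ℝ :=
  a ^ exitTime s Y x ω * Real.exp (-v * travel s Y x ω + w * overshoot s Y x ω)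

lemma exitWeight_of_mem {x : ℝ} {n : ℕ} {ω : Ω} (hω : ω ∈ exitsAt s Y x n) (a v w : ℝ) :
    exitWeight s Y x a v w ω =
      pathWeight Y a v (n + 1) ω * Real.exp (-(w * position s Y x (n + 1) ω)) := by
  rw [exitWeight, overshoot_of_mem hω, travel, exitTime_of_mem hω, pathWeight, mul_assoc,
    ← Real.exp_add]
  ring_nf

lemma exitWeight_nonneg {a : ℝ} (ha : 0 ≤ a) (x v w : ℝ) (ω : Ω) :
    0 ≤ exitWeight s Y x a v w ω := by
  unfold exitWeight; positivity

lemma exitWeight_one_eq_abs {x : ℝ} (hx : 0 ≤ x) {ω : Ω} (hω : ω ∈ exits s Y x) (v w : ℝ) :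
    exitWeight s Y x 1 v w ω =
      Real.exp (-v * travel s Y x ω + w * |overshoot s Y x ω|) := by
  rw [abs_of_pos (overshoot_pos hx hω), exitWeight, one_pow, one_mul]

variable [MeasurableSpace Ω] {P : Measure Ω}

lemma IsRenewalSteps.measurable_position {p : ℝ} {ν : Measure ℝ} (h : IsRenewalSteps P p ν s Y)
    (x : ℝ) (n : ℕ) : Measurable (position s Y x n) :=
  (measurable_position_past x le_rfl).mono (h.past_le n) le_rfl

lemma IsRenewalSteps.measurable_pathWeight {p : ℝ} {ν : Measure ℝ} (h : IsRenewalSteps P p ν s Y)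
    (a v : ℝ) (n : ℕ) : Measurable (pathWeight Y a v n) :=
  (measurable_pathWeight_past (s := s) a v n).mono (h.past_le n) le_rfl

lemma IsRenewalSteps.measurableSet_survives {p : ℝ} {ν : Measure ℝ}
    (h : IsRenewalSteps P p ν s Y) (x : ℝ) (n : ℕ) : MeasurableSet (survives s Y x n) :=
  h.past_le n _ (measurableSet_survives_past x n)

lemma IsRenewalSteps.measurableSet_exitsAt {p : ℝ} {ν : Measure ℝ}
    (h : IsRenewalSteps P p ν s Y) (x : ℝ) (n : ℕ) : MeasurableSet (exitsAt s Y x n) :=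
  (h.measurableSet_survives x n).inter (h.measurable_position x (n + 1) measurableSet_Iio)

lemma IsRenewalSteps.measurableSet_exits {p : ℝ} {ν : Measure ℝ}
    (h : IsRenewalSteps P p ν s Y) {x : ℝ} (hx : 0 ≤ x) : MeasurableSet (exits s Y x) := by
  rw [exits_eq_iUnion hx]
  exact MeasurableSet.iUnion fun n => h.measurableSet_exitsAt x n

lemma IsRenewalSteps.ae_length_pos {p μ : ℝ} (h : IsRenewalSteps P p (expMeasure μ) s Y) :
    ∀ᵐ ω ∂P, ∀ i, 0 < Y i ω := by
  refine ae_all_iff.2 fun i => ?_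
  have := ae_expMeasure_pos μ
  rw [← h.law_length i] at this
  exact ae_of_ae_map (h.measurable_length i).aemeasurable this

lemma IsRenewalSteps.aestronglyMeasurable_exitWeight {p : ℝ} {ν : Measure ℝ}
    (h : IsRenewalSteps P p ν s Y) {x : ℝ} (hx : 0 ≤ x) (a v w : ℝ) :
    AEStronglyMeasurable (exitWeight s Y x a v w) (P.restrict (exits s Y x)) := by
  rw [exits_eq_iUnion hx, aestronglyMeasurable_iUnion_iff]
  intro n
  have hm : Measurable fun ω => pathWeight Y a v (n + 1) ω *
      Real.exp (-(w * position s Y x (n + 1) ω)) := by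
    have h1 := h.measurable_pathWeight a v (n + 1)
    have h2 := h.measurable_position x (n + 1)
    fun_prop
  refine hm.aestronglyMeasurable.congr ?_
  filter_upwards [ae_restrict_mem (h.measurableSet_exitsAt x n)] with ω hω
  exact (exitWeight_of_mem hω a v w).symm

/-- On survival the position is nonnegative, so the harmonic function is at most `C`; almost surely
all lengths are positive, so the path weight is at most `a ^ n`. This bounds the stopping remainder
both for `a < 1` and for `a = 1`. -/
lemma lintegral_survives_le {μ a v w c : ℝ} (ha : 0 ≤ a) (hv : 0 ≤ v)
    (hw : w < μ + v) (hc : 0 ≤ c) (hcl : c < μ + v)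
    (h : IsRenewalSteps P (1 / 2) (expMeasure μ) s Y) (x : ℝ) (n : ℕ) :
    ∫⁻ ω in survives s Y x n, ENNReal.ofReal (pathWeight Y a v n ω *
        ((μ + v - c) / (μ + v - w) * Real.exp (-(c * position s Y x n ω)))) ∂P ≤
      ENNReal.ofReal ((μ + v - c) / (μ + v - w)) * ENNReal.ofReal a ^ n * P (survives s Y x n) := by
  have hC : 0 ≤ (μ + v - c) / (μ + v - w) := div_nonneg (by linarith) (by linarith)
  rw [← ENNReal.ofReal_pow ha, ← ENNReal.ofReal_mul hC, ← setLIntegral_const]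
  refine setLIntegral_mono_ae measurable_const.aemeasurable ?_
  filter_upwards [h.ae_length_pos] with ω hY hω
  refine ENNReal.ofReal_le_ofReal ?_
  have e1 : Real.exp (-(c * position s Y x n ω)) ≤ 1 :=
    Real.exp_le_one_iff.2 (neg_nonpos.2 (mul_nonneg hc (hω n le_rfl)))
  have e2 : pathWeight Y a v n ω ≤ a ^ n := by
    refine mul_le_of_le_one_right (by positivity) (Real.exp_le_one_iff.2 (neg_nonpos.2
      (mul_nonneg hv (Finset.sum_nonneg fun i _ => (hY i).le))))
  calc _ ≤ a ^ n * ((μ + v - c) / (μ + v - w) * 1) := by gcongr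
    _ = _ := by ring

lemma reflectedFrom_eq {p : ℝ} {ν : Measure ℝ} (h : IsRenewalSteps P p ν s Y) {x : ℝ}
    (hx : 0 ≤ x) (β : ℝ) :
    reflectedFrom P s Y β x = ∫ ω in exits s Y x, exitWeight s Y x 1 β β ω ∂P :=
  setIntegral_congr_fun (h.measurableSet_exits hx) fun _ hω =>
    (exitWeight_one_eq_abs hx hω β β).symm

variable [IsProbabilityMeasure P]

/-- One step of the martingale of `exitHarmonic`. -/
lemma lintegral_survives_eq_add {μ a v w c : ℝ} (hμ : 0 < μ) (ha : 0 ≤ a) (hw : w < μ + v)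
    (hc : 0 ≤ c) (hcl : c < μ + v) (hcc : c ^ 2 = (μ + v) ^ 2 - (μ + v) * (a * μ))
    (h : IsRenewalSteps P (1 / 2) (expMeasure μ) s Y) (x : ℝ) (n : ℕ) :
    ∫⁻ ω in survives s Y x n, ENNReal.ofReal (pathWeight Y a v n ω *
        ((μ + v - c) / (μ + v - w) * Real.exp (-(c * position s Y x n ω)))) ∂P =
      ∫⁻ ω in exitsAt s Y x n, ENNReal.ofReal (pathWeight Y a v (n + 1) ω *
        Real.exp (-(w * position s Y x (n + 1) ω))) ∂P +
      ∫⁻ ω in survives s Y x (n + 1), ENNReal.ofReal (pathWeight Y a v (n + 1) ω *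
        ((μ + v - c) / (μ + v - w) * Real.exp (-(c * position s Y x (n + 1) ω)))) ∂P := by
  have := isProbabilityMeasure_expMeasure hμ
  set C := (μ + v - c) / (μ + v - w) with hC
  have hH := measurable_exitHarmonic C c w
  have hS := h.measurableSet_survives x n
  have hneg : MeasurableSet {ω | position s Y x (n + 1) ω < 0} :=
    h.measurable_position x (n + 1) measurableSet_Iio
  have hsplit := lintegral_inter_add_sdiff (μ := P)
    (fun ω => ENNReal.ofReal (pathWeight Y a v (n + 1) ω *
      exitHarmonic C c w (position s Y x (n + 1) ω))) (survives s Y x n) hneg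
  have eB : ∫⁻ ω in survives s Y x n ∩ {ω | position s Y x (n + 1) ω < 0},
      ENNReal.ofReal (pathWeight Y a v (n + 1) ω *
        exitHarmonic C c w (position s Y x (n + 1) ω)) ∂P =
      ∫⁻ ω in exitsAt s Y x n, ENNReal.ofReal (pathWeight Y a v (n + 1) ω *
        Real.exp (-(w * position s Y x (n + 1) ω))) ∂P := by
    refine setLIntegral_congr_fun (h.measurableSet_exitsAt x n) fun ω hω => ?_
    simp only [exitHarmonic, if_pos hω.2.out]
  have eA : ∫⁻ ω in survives s Y x n \ {ω | position s Y x (n + 1) ω < 0},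
      ENNReal.ofReal (pathWeight Y a v (n + 1) ω *
        exitHarmonic C c w (position s Y x (n + 1) ω)) ∂P =
      ∫⁻ ω in survives s Y x (n + 1), ENNReal.ofReal (pathWeight Y a v (n + 1) ω *
        (C * Real.exp (-(c * position s Y x (n + 1) ω)))) ∂P := by
    rw [sdiff_eq, ← survives_succ]
    refine setLIntegral_congr_fun (h.measurableSet_survives x (n + 1)) fun ω hω => ?_
    simp only [exitHarmonic, if_neg (not_lt.2 (hω (n + 1) le_rfl))]
  rw [← eA, ← eB, hsplit]
  -- Carrying the survival indicator inside the weight turns the claim into an integral over all of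
  -- `Ω` of a function of past data and one fresh step.
  let W : Ω → ENNReal := (survives s Y x n).indicator fun ω => ENNReal.ofReal (pathWeight Y a v n ω)
  have hW : Measurable[past s Y n] W :=
    ((measurable_pathWeight_past a v n).ennreal_ofReal).indicator (measurableSet_survives_past x n)
  have hU : Measurable[past s Y n] fun ω => (position s Y x n ω, W ω) :=
    (measurable_position_past x le_rfl).prodMk hW
  have key := h.lintegral_next n hU (F := fun u e y => u.2 *
    (ENNReal.ofReal (a * Real.exp (-(v * y))) * ENNReal.ofReal (exitHarmonic C c w (u.1 + e * y))))
    (by fun_prop)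
  rw [← lintegral_indicator hS, ← lintegral_indicator hS]
  refine Eq.trans ?_ (key.symm.trans ?_)
  · refine lintegral_congr fun ω => ?_
    by_cases hω : ω ∈ survives s Y x n
    · have hmv := exitHarmonic_mean_value hμ ha hw hc hcl hcc (hω n le_rfl)
      simp only [one_mul, neg_mul, ← sub_eq_add_neg]
      rw [lintegral_const_mul _ (by fun_prop), lintegral_const_mul _ (by fun_prop),
        mul_left_comm, mul_left_comm (2⁻¹ : ENNReal), ← mul_add, hmv]
      simp only [W, indicator_of_mem hω]
      rw [ENNReal.ofReal_mul (pathWeight_nonneg ha v n ω)]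
    · simp [W, indicator_of_notMem hω]
  · refine lintegral_congr fun ω => ?_
    by_cases hω : ω ∈ survives s Y x n
    · simp only [W, indicator_of_mem hω]
      rw [← position_succ, pathWeight_succ, ENNReal.ofReal_mul
        (mul_nonneg (pathWeight_nonneg ha v n ω) (by positivity)),
        ENNReal.ofReal_mul (pathWeight_nonneg ha v n ω), mul_assoc]
    · simp [W, indicator_of_notMem hω]

/-- The one-step identities telescope to the initial value, all in `ENNReal`, so no integrability is
needed. The vanishing of the remainder stays a hypothesis because it is met twice: by geometric
decay before almost sure exit is known, and by that fact afterwards. -/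
lemma setLIntegral_exitWeight_of_tendsto {μ a v w c : ℝ} (hμ : 0 < μ) (ha : 0 ≤ a)
    (hw : w < μ + v) (hc : 0 ≤ c) (hcl : c < μ + v)
    (hcc : c ^ 2 = (μ + v) ^ 2 - (μ + v) * (a * μ))
    (h : IsRenewalSteps P (1 / 2) (expMeasure μ) s Y) {x : ℝ} (hx : 0 ≤ x)
    (hlim : Tendsto (fun n => ∫⁻ ω in survives s Y x n, ENNReal.ofReal (pathWeight Y a v n ω *
        ((μ + v - c) / (μ + v - w) * Real.exp (-(c * position s Y x n ω)))) ∂P) atTop (𝓝 0)) :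
    ∫⁻ ω in exits s Y x, ENNReal.ofReal (exitWeight s Y x a v w ω) ∂P =
      ENNReal.ofReal ((μ + v - c) / (μ + v - w) * Real.exp (-(c * x))) := by
  rw [exits_eq_iUnion hx, lintegral_iUnion (fun n => h.measurableSet_exitsAt x n)
    (pairwise_disjoint_exitsAt x)]
  have hB : ∀ n, ∫⁻ ω in exitsAt s Y x n, ENNReal.ofReal (exitWeight s Y x a v w ω) ∂P =
      ∫⁻ ω in exitsAt s Y x n, ENNReal.ofReal (pathWeight Y a v (n + 1) ω *
        Real.exp (-(w * position s Y x (n + 1) ω))) ∂P := fun n =>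
    setLIntegral_congr_fun (h.measurableSet_exitsAt x n) fun ω hω => by
      simp only [exitWeight_of_mem hω]
  simp only [hB]
  have hstep := lintegral_survives_eq_add hμ ha hw hc hcl hcc h x
  set A : ℕ → ENNReal := fun n => ∫⁻ ω in survives s Y x n, ENNReal.ofReal (pathWeight Y a v n ω *
        ((μ + v - c) / (μ + v - w) * Real.exp (-(c * position s Y x n ω)))) ∂P with hA
  set B : ℕ → ENNReal := fun n => ∫⁻ ω in exitsAt s Y x n, ENNReal.ofReal
        (pathWeight Y a v (n + 1) ω * Real.exp (-(w * position s Y x (n + 1) ω))) ∂P with hBdef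
  have hA0 : A 0 = ENNReal.ofReal ((μ + v - c) / (μ + v - w) * Real.exp (-(c * x))) := by
    have hs : survives s Y x 0 = univ := by ext ω; simp [survives, position, hx]
    simp [hA, hs, pathWeight, position]
  have hsum : ∀ n, A 0 = ∑ i ∈ Finset.range n, B i + A n := by
    intro n
    induction n with
    | zero => simp
    | succ n ih => rw [ih, Finset.sum_range_succ, add_assoc]; exact congrArg _ (hstep n)
  have ht : Tendsto (fun n => ∑ i ∈ Finset.range n, B i + A n) atTop (𝓝 (∑' i, B i + 0)) :=
    (ENNReal.tendsto_nat_tsum B).add hlim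
  rw [add_zero] at ht
  rw [← hA0]
  refine tendsto_nhds_unique ht ?_
  simp only [← hsum]
  exact tendsto_const_nhds

/-- A symmetric walk leaves the half-line almost surely. -/
lemma IsRenewalSteps.ae_mem_exits {μ : ℝ} (hμ : 0 < μ)
    (h : IsRenewalSteps P (1 / 2) (expMeasure μ) s Y) {x : ℝ} (hx : 0 ≤ x) :
    ∀ᵐ ω ∂P, ω ∈ exits s Y x := by
  -- For `v = w = 0` the transform is `𝔼 a ^ T` over the exiting walks, hence a lower bound for the
  -- exit probability; here `c = μ √(1 - a)`.
  have hle : ∀ a ∈ Ioo (0 : ℝ) 1,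
      ENNReal.ofReal ((1 - √(1 - a)) * Real.exp (-(μ * √(1 - a) * x))) ≤ P (exits s Y x) := by
    intro a ha
    have hr0 := Real.sqrt_nonneg (1 - a)
    have hr1 : √(1 - a) < 1 := by rw [Real.sqrt_lt' one_pos]; linarith [ha.1]
    have hrr : √(1 - a) ^ 2 = 1 - a := Real.sq_sqrt (by linarith [ha.2])
    have hc : μ * √(1 - a) < μ + 0 := by nlinarith
    have hlim := setLIntegral_exitWeight_of_tendsto (w := 0) (c := μ * √(1 - a)) (v := 0) hμ
      ha.1.le (by linarith) (by positivity) hc (by rw [mul_pow, hrr]; ring) h hx (by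
        refine tendsto_of_tendsto_of_tendsto_of_le_of_le tendsto_const_nhds ?_
          (fun n => zero_le) (fun n => (lintegral_survives_le ha.1.le le_rfl (by linarith)
            (by positivity) hc h x n).trans (mul_le_of_le_one_right' prob_le_one))
        have := ENNReal.Tendsto.const_mul (ENNReal.tendsto_pow_atTop_nhds_zero_of_lt_one
          (r := ENNReal.ofReal a) (by simpa using ha.2))
          (Or.inr (ENNReal.ofReal_ne_top (r := (μ + 0 - μ * √(1 - a)) / (μ + 0 - 0))))
        simpa using this)
    have e : (μ + 0 - μ * √(1 - a)) / (μ + 0 - 0) = 1 - √(1 - a) := by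
      rw [add_zero, sub_zero, sub_div, div_self hμ.ne', mul_div_cancel_left₀ _ hμ.ne']
    rw [e] at hlim
    rw [← hlim, ← setLIntegral_one]
    refine lintegral_mono fun ω => ?_
    rw [ENNReal.ofReal_le_one]
    simpa [exitWeight] using pow_le_one₀ ha.1.le ha.2.le
  have ht : Tendsto (fun a : ℝ => ENNReal.ofReal ((1 - √(1 - a)) *
      Real.exp (-(μ * √(1 - a) * x)))) (𝓝[<] 1) (𝓝 1) := by
    have hc : Continuous (fun a : ℝ => ENNReal.ofReal ((1 - √(1 - a)) *
      Real.exp (-(μ * √(1 - a) * x)))) := ENNReal.continuous_ofReal.comp (by fun_prop)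
    have := (hc.tendsto 1).mono_left (nhdsWithin_le_nhds (s := Iio 1))
    simpa using this
  have h1 : 1 ≤ P (exits s Y x) := by
    refine le_of_tendsto ht ?_
    filter_upwards [Ioo_mem_nhdsLT (zero_lt_one' ℝ)] with a ha using hle a ha
  exact mem_ae_iff_prob_eq_one (h.measurableSet_exits hx) |>.2 (le_antisymm prob_le_one h1)

lemma IsRenewalSteps.tendsto_prob_survives {μ : ℝ} (hμ : 0 < μ)
    (h : IsRenewalSteps P (1 / 2) (expMeasure μ) s Y) {x : ℝ} (hx : 0 ≤ x) :
    Tendsto (fun n => P (survives s Y x n)) atTop (𝓝 0) := by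
  have hz : P (⋂ n, survives s Y x n) = 0 := by
    refine measure_mono_null ?_ (mem_ae_iff.1 (h.ae_mem_exits hμ hx))
    intro ω hω hω'
    obtain ⟨n, hn⟩ := hω'
    exact not_lt.2 (mem_iInter.1 hω n n le_rfl) hn
  rw [← hz]
  refine tendsto_measure_iInter_atTop (fun n => (h.measurableSet_survives x n).nullMeasurableSet)
    (fun m n hmn ω hω k hk => hω k (hk.trans hmn)) ⟨0, measure_ne_top _ _⟩

/-- The joint transform of exit time, travel and overshoot of the exponential walk. -/
lemma setLIntegral_exitWeight {μ a v w c : ℝ} (hμ : 0 < μ) (ha : 0 ≤ a) (ha1 : a ≤ 1)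
    (hv : 0 ≤ v) (hw : w < μ + v) (hc : 0 ≤ c) (hcl : c < μ + v)
    (hcc : c ^ 2 = (μ + v) ^ 2 - (μ + v) * (a * μ))
    (h : IsRenewalSteps P (1 / 2) (expMeasure μ) s Y) {x : ℝ} (hx : 0 ≤ x) :
    ∫⁻ ω in exits s Y x, ENNReal.ofReal (exitWeight s Y x a v w ω) ∂P =
      ENNReal.ofReal ((μ + v - c) / (μ + v - w) * Real.exp (-(c * x))) := by
  refine setLIntegral_exitWeight_of_tendsto hμ ha hw hc hcl hcc h hx ?_
  refine tendsto_of_tendsto_of_tendsto_of_le_of_le tendsto_const_nhds ?_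
    (fun n => zero_le) (fun n => (lintegral_survives_le ha hv hw hc hcl h x n).trans
      (mul_le_mul_left (mul_le_of_le_one_right' (pow_le_one' (by simpa using ha1) n)) _))
  simpa using ENNReal.Tendsto.const_mul (h.tendsto_prob_survives hμ hx)
    (Or.inr (ENNReal.ofReal_ne_top (r := (μ + v - c) / (μ + v - w))))

lemma integrableOn_exitWeight {μ a v w c : ℝ} (hμ : 0 < μ) (ha : 0 ≤ a) (ha1 : a ≤ 1)
    (hv : 0 ≤ v) (hw : w < μ + v) (hc : 0 ≤ c) (hcl : c < μ + v)
    (hcc : c ^ 2 = (μ + v) ^ 2 - (μ + v) * (a * μ))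
    (h : IsRenewalSteps P (1 / 2) (expMeasure μ) s Y) {x : ℝ} (hx : 0 ≤ x) :
    IntegrableOn (exitWeight s Y x a v w) (exits s Y x) P := by
  refine ⟨h.aestronglyMeasurable_exitWeight hx a v w, ?_⟩
  rw [hasFiniteIntegral_iff_ofReal (ae_of_all _ (exitWeight_nonneg ha x v w)),
    setLIntegral_exitWeight hμ ha ha1 hv hw hc hcl hcc h hx]
  exact ENNReal.ofReal_lt_top

lemma setIntegral_exitWeight {μ a v w c : ℝ} (hμ : 0 < μ) (ha : 0 ≤ a) (ha1 : a ≤ 1)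
    (hv : 0 ≤ v) (hw : w < μ + v) (hc : 0 ≤ c) (hcl : c < μ + v)
    (hcc : c ^ 2 = (μ + v) ^ 2 - (μ + v) * (a * μ))
    (h : IsRenewalSteps P (1 / 2) (expMeasure μ) s Y) {x : ℝ} (hx : 0 ≤ x) :
    ∫ ω in exits s Y x, exitWeight s Y x a v w ω ∂P =
      (μ + v - c) / (μ + v - w) * Real.exp (-(c * x)) := by
  rw [integral_eq_lintegral_of_nonneg_ae (ae_of_all _ (exitWeight_nonneg ha x v w))
    (h.aestronglyMeasurable_exitWeight hx a v w),
    setLIntegral_exitWeight hμ ha ha1 hv hw hc hcl hcc h hx, ENNReal.toReal_ofReal]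
  exact mul_nonneg (div_nonneg (by linarith) (by linarith)) (Real.exp_pos _).le

end ExitFunctional

/-! ### Laplace transform and mean of the exponential and depth laws. -/

lemma lintegral_exp_neg_expMeasure {μ v : ℝ} (hμ : 0 < μ) (hv : 0 < μ + v) :
    ∫⁻ y, ENNReal.ofReal (Real.exp (-v * y)) ∂(expMeasure μ) = ENNReal.ofReal (μ / (μ + v)) := by
  rw [lintegral_expMeasure μ (by fun_prop),
    setLIntegral_congr_fun (g := fun y => ENNReal.ofReal μ *
      ENNReal.ofReal (Real.exp (-((μ + v) * y)))) measurableSet_Ioi,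
    lintegral_const_mul _ (by fun_prop), lintegral_exp_Ioi hv, ← ENNReal.ofReal_mul hμ.le]
  · simp [div_eq_mul_inv]
  · intro y _
    simp only
    rw [← ENNReal.ofReal_mul (by positivity), ← ENNReal.ofReal_mul hμ.le, mul_assoc,
      ← Real.exp_add]
    ring_nf

lemma integrable_exp_neg_expMeasure {μ v : ℝ} (hμ : 0 < μ) (hv : 0 < μ + v) :
    Integrable (fun y => Real.exp (-v * y)) (expMeasure μ) := by
  refine ⟨by fun_prop, ?_⟩
  rw [hasFiniteIntegral_iff_ofReal (ae_of_all _ fun _ => (Real.exp_pos _).le),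
    lintegral_exp_neg_expMeasure hμ hv]
  exact ENNReal.ofReal_lt_top

lemma laplace_expMeasure {μ v : ℝ} (hμ : 0 < μ) (hv : 0 < μ + v) :
    laplace (expMeasure μ) v = μ / (μ + v) := by
  rw [laplace, integral_eq_lintegral_of_nonneg_ae (ae_of_all _ fun _ => (Real.exp_pos _).le)
    (by fun_prop), lintegral_exp_neg_expMeasure hμ hv, ENNReal.toReal_ofReal (by positivity)]

lemma integral_id_expMeasure_pos {μ : ℝ} (hμ : 0 < μ) : 0 < ∫ y, y ∂(expMeasure μ) := by
  have := isProbabilityMeasure_expMeasure hμ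
  have hi : Integrable (fun y : ℝ => y) (expMeasure μ) := by
    -- Domination by `y ≤ (2 / μ) exp (μ y / 2)`; the rate `μ / 2` is below `μ`.
    refine ((integrable_exp_neg_expMeasure (v := -(μ / 2)) hμ (by linarith)).const_mul
      (2 / μ)).mono' (by fun_prop) ?_
    filter_upwards [ae_expMeasure_pos μ] with y hy
    rw [Real.norm_of_nonneg hy.le, neg_neg]
    have := Real.add_one_le_exp (μ / 2 * y)
    calc y = 2 / μ * (μ / 2 * y) := by field_simp
      _ ≤ _ := by gcongr; linarith
  rw [integral_pos_iff_support_of_nonneg_ae ((ae_expMeasure_pos μ).mono fun y hy => hy.le) hi]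
  have hs : Function.support (fun y : ℝ => y) ∈ ae (expMeasure μ) :=
    (ae_expMeasure_pos μ).mono fun y hy => hy.ne'
  rw [measure_eq_measure_of_null_sdiff (subset_univ _) (by
    rw [← compl_eq_univ_sdiff]; exact mem_ae_iff.1 hs), measure_univ]
  exact one_pos

section DepthLaw

lemma depthLaw_zero (ν : Measure ℝ) : depthLaw ν 0 = ν := by simp [depthLaw]

lemma ae_depthLaw_pos {μ θ : ℝ} (hθ : 0 < Real.cos θ) :
    ∀ᵐ x ∂(depthLaw (expMeasure μ) θ), 0 < x := by
  rw [depthLaw, ae_map_iff (by fun_prop) measurableSet_Ioi]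
  filter_upwards [ae_expMeasure_pos μ] with y hy
  positivity

lemma integral_id_depthLaw_pos {μ θ : ℝ} (hμ : 0 < μ) (hθ : 0 < Real.cos θ) :
    0 < ∫ x, x ∂(depthLaw (expMeasure μ) θ) := by
  rw [depthLaw, integral_map (by fun_prop) (by fun_prop), integral_mul_const]
  exact mul_pos (integral_id_expMeasure_pos hμ) hθ

lemma integral_exp_neg_depthLaw {μ θ v : ℝ} (hμ : 0 < μ) (hv : 0 < μ + v * Real.cos θ) :
    ∫ x, Real.exp (-v * x) ∂(depthLaw (expMeasure μ) θ) = μ / (μ + v * Real.cos θ) := by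
  rw [depthLaw, integral_map (by fun_prop) (by fun_prop), ← laplace_expMeasure hμ hv, laplace]
  refine integral_congr_ae (ae_of_all _ fun y => ?_)
  ring_nf

end DepthLaw

/-! ### Special cases of the joint transform. -/

section Transforms

variable {Ω : Type*} {s Y : ℕ → Ω → ℝ} [MeasurableSpace Ω] {P : Measure Ω}
  [IsProbabilityMeasure P] {μ : ℝ}

/-- With `a = 1` and `v = 0` the quadratic forces `c = 0`, so the dependence on `x` disappears: the
memoryless property of the step length. -/
lemma integral_exp_overshoot (hμ : 0 < μ) (h : IsRenewalSteps P (1 / 2) (expMeasure μ) s Y)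
    {x w : ℝ} (hx : 0 ≤ x) (hw : w < μ) :
    ∫ ω in exits s Y x, Real.exp (w * overshoot s Y x ω) ∂P = μ / (μ - w) := by
  have := setIntegral_exitWeight (a := 1) (v := 0) (w := w) (c := 0) hμ zero_le_one le_rfl le_rfl
    (by linarith) le_rfl (by linarith) (by ring) h hx
  simpa [exitWeight] using this

lemma overshootMGF_eq (hμ : 0 < μ) (h : IsRenewalSteps P (1 / 2) (expMeasure μ) s Y)
    {x w : ℝ} (hx : 0 ≤ x) (hw : w < μ) : overshootMGF P s Y x w = μ / (μ - w) := by
  rw [← integral_exp_overshoot hμ h hx hw, overshootMGF]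
  refine setIntegral_congr_fun (h.measurableSet_exits hx) fun ω hω => ?_
  simp only [abs_of_pos (overshoot_pos hx hω)]

lemma integrableOn_exp_overshoot (hμ : 0 < μ) (h : IsRenewalSteps P (1 / 2) (expMeasure μ) s Y)
    {x w : ℝ} (hx : 0 ≤ x) (hw : w < μ) :
    IntegrableOn (fun ω => Real.exp (w * |overshoot s Y x ω|)) (exits s Y x) P := by
  refine (integrableOn_exitWeight (a := 1) (v := 0) (w := w) (c := 0) hμ zero_le_one le_rfl le_rfl
    (by linarith) le_rfl (by linarith) (by ring) h hx).congr_fun (fun ω hω => ?_)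
    (h.measurableSet_exits hx)
  simp [exitWeight_one_eq_abs hx hω]

lemma sqrt_div_one_add_lt_one {t : ℝ} (ht : 0 ≤ t) : √(t / (1 + t)) < 1 := by
  rw [Real.sqrt_lt' one_pos, one_pow, div_lt_one (by linarith)]
  linarith

lemma sq_sqrt_div_one_add {t : ℝ} (ht : 0 ≤ t) : √(t / (1 + t)) ^ 2 = t / (1 + t) :=
  Real.sq_sqrt (div_nonneg ht (by linarith))

/-- The exit time of the walk killed with the Laplace transform of a step length. -/
lemma exitTimeGF_eq (hμ : 0 < μ) (h : IsRenewalSteps P (1 / 2) (expMeasure μ) s Y)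
    {x t : ℝ} (hx : 0 ≤ x) (ht : 0 ≤ t) :
    exitTimeGF P s Y x (laplace (expMeasure μ) (t * μ)) =
      (1 - √(t / (1 + t))) * Real.exp (-(μ * √(t / (1 + t)) * x)) := by
  have hr := sqrt_div_one_add_lt_one ht
  have hc : μ * √(t / (1 + t)) < μ := mul_lt_of_lt_one_right hμ hr
  have ht1 : 0 < 1 + t := by linarith
  have e := setIntegral_exitWeight (a := 1 / (1 + t)) (v := 0) (w := 0) (c := μ * √(t / (1 + t))) hμ
    (by positivity) (by rw [div_le_one ht1]; linarith) le_rfl (by linarith) (by positivity)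
    (by linarith) (by rw [mul_pow, sq_sqrt_div_one_add ht]; field_simp; ring) h hx
  have hl : laplace (expMeasure μ) (t * μ) = 1 / (1 + t) := by
    rw [laplace_expMeasure hμ (by positivity)]; field_simp
  rw [exitTimeGF, hl]
  have hC : (μ + 0 - μ * √(t / (1 + t))) / (μ + 0 - 0) = 1 - √(t / (1 + t)) := by
    rw [add_zero, sub_zero, sub_div, div_self hμ.ne', mul_div_cancel_left₀ _ hμ.ne']
  rw [hC] at e
  simpa [exitWeight] using e

/-- The travel of the killed walk, compared with its exit time. -/
lemma integral_exp_travel_le (hμ : 0 < μ) (h : IsRenewalSteps P (1 / 2) (expMeasure μ) s Y)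
    {x t : ℝ} (hx : 0 ≤ x) (ht : 0 ≤ t) :
    IntegrableOn (exitWeight s Y x 1 (t * μ) 0) (exits s Y x) P ∧
    ∫ ω in exits s Y x, exitWeight s Y x 1 (t * μ) 0 ω ∂P ≤
      exitTimeGF P s Y x (laplace (expMeasure μ) (t * μ)) := by
  have hr := sqrt_div_one_add_lt_one ht
  have hr0 := Real.sqrt_nonneg (t / (1 + t))
  have hm : 0 < μ + t * μ := by positivity
  -- The root is `1 + t` times the one in `exitTimeGF_eq`. The prefactors agree, so only the
  -- exponents have to be compared.
  have hc : (μ + t * μ) * √(t / (1 + t)) < μ + t * μ := mul_lt_of_lt_one_right hm hr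
  have hcc : ((μ + t * μ) * √(t / (1 + t))) ^ 2 =
      (μ + t * μ) ^ 2 - (μ + t * μ) * (1 * μ) := by
    rw [mul_pow, sq_sqrt_div_one_add ht]; field_simp; ring
  refine ⟨integrableOn_exitWeight hμ zero_le_one le_rfl (by positivity) hm (by positivity) hc hcc
    h hx, ?_⟩
  rw [exitTimeGF_eq hμ h hx ht, setIntegral_exitWeight hμ zero_le_one le_rfl (by positivity) hm
    (by positivity) hc hcc h hx]
  have hC : (μ + t * μ - (μ + t * μ) * √(t / (1 + t))) / (μ + t * μ - 0) =
      1 - √(t / (1 + t)) := by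
    rw [sub_zero, sub_div, div_self hm.ne', mul_div_cancel_left₀ _ hm.ne']
  rw [hC]
  refine mul_le_mul_of_nonneg_left (Real.exp_le_exp.2 (neg_le_neg ?_)) (by linarith)
  gcongr
  nlinarith

/-- The case `a = 1`, `v = w = β`, where `c ^ 2 = β (μ + β)`. Only the exponential shape in `x`
matters, for integrability over the depth. -/
lemma exists_reflectedFrom_eq (hμ : 0 < μ) (h : IsRenewalSteps P (1 / 2) (expMeasure μ) s Y)
    {β : ℝ} (hβ : 0 ≤ β) :
    ∃ C c : ℝ, 0 ≤ c ∧ ∀ x, 0 ≤ x →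
      IntegrableOn (exitWeight s Y x 1 β β) (exits s Y x) P ∧
      ∫ ω in exits s Y x, exitWeight s Y x 1 β β ω ∂P = C * Real.exp (-(c * x)) := by
  have hs : √(β * (μ + β)) ^ 2 = β * (μ + β) := Real.sq_sqrt (by positivity)
  have hc : √(β * (μ + β)) < μ + β := by
    rw [Real.sqrt_lt' (by linarith)]; nlinarith
  have hcc : √(β * (μ + β)) ^ 2 = (μ + β) ^ 2 - (μ + β) * (1 * μ) := by rw [hs]; ring
  exact ⟨_, _, Real.sqrt_nonneg _, fun x hx =>
    ⟨integrableOn_exitWeight hμ zero_le_one le_rfl hβ (by linarith) (Real.sqrt_nonneg _) hc hcc h hx,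
      setIntegral_exitWeight hμ zero_le_one le_rfl hβ (by linarith) (Real.sqrt_nonneg _) hc hcc
        h hx⟩⟩

end Transforms

/-! ### The limit of the delta-method estimate. -/

section Estimate

variable {Ω : Type*} {s Y : ℕ → Ω → ℝ} [MeasurableSpace Ω] {P : Measure Ω}
  [IsProbabilityMeasure P] {μ : ℝ}

lemma overshootDiff_eq (hμ : 0 < μ) (h : IsRenewalSteps P (1 / 2) (expMeasure μ) s Y)
    {D : Measure ℝ} [IsProbabilityMeasure D] (hD : ∀ᵐ x ∂D, 0 < x) (hm : 0 < ∫ t, t ∂D)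
    {ε : ℝ} (hε : 0 < ε) :
    overshootDiff P s Y D ε =
      -μ / ((μ + 2 * (ε / ∫ t, t ∂D)) * (μ + ε / ∫ t, t ∂D)) := by
  have key : ∀ ζ : ℝ, 0 < ζ →
      ∫ x, ∫ ω in exits s Y x, Real.exp (-ζ * overshoot s Y x ω) ∂P ∂D = μ / (μ + ζ) := by
    intro ζ hζ
    rw [integral_congr_ae (g := fun _ => μ / (μ + ζ))]
    · simp
    · filter_upwards [hD] with x hx
      rw [integral_exp_overshoot hμ h hx.le (by linarith), sub_neg_eq_add]
  have hζ : 0 < ε / ∫ t, t ∂D := div_pos hε hm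
  rw [overshootDiff, mul_div_assoc, key _ hζ, key _ (by linarith)]
  field_simp
  ring

/-- The difference quotient converges to minus the mean overshoot. -/
lemma tendsto_overshootDiff (hμ : 0 < μ) (h : IsRenewalSteps P (1 / 2) (expMeasure μ) s Y)
    {D : Measure ℝ} [IsProbabilityMeasure D] (hD : ∀ᵐ x ∂D, 0 < x) (hm : 0 < ∫ t, t ∂D) :
    Tendsto (overshootDiff P s Y D) (𝓝[>] 0) (𝓝 (-(1 / μ))) := by
  have hc : ContinuousAt (fun ε : ℝ =>
      -μ / ((μ + 2 * (ε / ∫ t, t ∂D)) * (μ + ε / ∫ t, t ∂D))) 0 := by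
    refine ContinuousAt.div (by fun_prop) (by fun_prop) ?_
    simp [hμ.ne']
  have ht := hc.tendsto.mono_left (nhdsWithin_le_nhds (s := Ioi 0))
  have hv : -μ / ((μ + 2 * (0 / ∫ t, t ∂D)) * (μ + 0 / ∫ t, t ∂D)) = -(1 / μ) := by
    simp only [zero_div, mul_zero, add_zero]
    field_simp
  rw [hv] at ht
  refine ht.congr' ?_
  filter_upwards [self_mem_nhdsWithin] with ε hε
  exact (overshootDiff_eq hμ h hD hm hε).symm

lemma tendsto_deltaEstimate (hμ : 0 < μ) (h : IsRenewalSteps P (1 / 2) (expMeasure μ) s Y)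
    {η θ : ℝ} (hη : 0 ≤ η) (hθ : 0 < Real.cos θ) :
    Tendsto (fun ε => deltaEstimate P s Y (expMeasure μ) (depthLaw (expMeasure μ) θ) (η * μ) ε)
      (𝓝[>] 0) (𝓝 ((1 - √(2 * η / (1 + 2 * η))) *
          (1 + (η + √(2 * η / (1 + 2 * η))) * Real.cos θ)⁻¹ * (1 + η))) := by
  have := isProbabilityMeasure_expMeasure hμ
  have : IsProbabilityMeasure (depthLaw (expMeasure μ) θ) :=
    Measure.isProbabilityMeasure_map (by fun_prop)
  have hD := ae_depthLaw_pos (μ := μ) hθ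
  set r := √(2 * η / (1 + 2 * η)) with hr
  have hr0 : 0 ≤ r := Real.sqrt_nonneg _
  have hfirst : ∫ x, Real.exp (-(η * μ) * x) *
      exitTimeGF P s Y x (laplace (expMeasure μ) (2 * (η * μ))) ∂(depthLaw (expMeasure μ) θ) =
      (1 - r) * (1 + (η + r) * Real.cos θ)⁻¹ := by
    rw [integral_congr_ae (g := fun x => (1 - r) * Real.exp (-(μ * (η + r)) * x)),
      integral_const_mul, integral_exp_neg_depthLaw hμ (by positivity)]
    · have : 0 < 1 + (η + r) * Real.cos θ := by positivity
      rw [show μ + μ * (η + r) * Real.cos θ = μ * (1 + (η + r) * Real.cos θ) by ring]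
      field_simp
    · filter_upwards [hD] with x hx
      rw [← mul_assoc 2 η μ, exitTimeGF_eq hμ h hx.le (by positivity), ← hr, mul_left_comm,
        ← Real.exp_add]
      ring_nf
  have ht := ((tendsto_overshootDiff hμ h hD (integral_id_depthLaw_pos hμ hθ)).mul_const
    (η * μ)).const_sub 1 |>.const_mul ((1 - r) * (1 + (η + r) * Real.cos θ)⁻¹)
  have hv : 1 - -(1 / μ) * (η * μ) = 1 + η := by field_simp; ring
  rw [hv] at ht
  simp only [deltaEstimate, hfirst]
  exact ht

end Estimate

/-! ### The Cauchy-Schwarz upper bound. -/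

section Bound

variable {Ω : Type*} {s Y : ℕ → Ω → ℝ} [MeasurableSpace Ω] {P : Measure Ω}
  [IsProbabilityMeasure P] {μ : ℝ}

lemma integrable_reflectedFrom (hμ : 0 < μ) (h : IsRenewalSteps P (1 / 2) (expMeasure μ) s Y)
    {β : ℝ} (hβ : 0 ≤ β) :
    Integrable (fun x => Real.exp (-β * x) * reflectedFrom P s Y β x) (expMeasure μ) := by
  obtain ⟨C, c, hc, hC⟩ := exists_reflectedFrom_eq hμ h hβ
  refine ((integrable_exp_neg_expMeasure (v := β + c) hμ (by positivity)).const_mul C).congr ?_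
  filter_upwards [ae_expMeasure_pos μ] with x hx
  rw [reflectedFrom_eq h hx.le, (hC x hx.le).2, mul_left_comm, ← Real.exp_add]
  ring_nf

/-- Cauchy-Schwarz for the power reflected from a given depth. -/
lemma reflectedFrom_le (hμ : 0 < μ) (h : IsRenewalSteps P (1 / 2) (expMeasure μ) s Y)
    {η x : ℝ} (hη : 0 ≤ η) (hη1 : 2 * η < 1) (hx : 0 ≤ x) :
    reflectedFrom P s Y (η * μ) x ≤
      √(exitTimeGF P s Y x (laplace (expMeasure μ) (2 * η * μ)) *
        overshootMGF P s Y x (2 * η * μ)) := by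
  obtain ⟨hfi, hfle⟩ := integral_exp_travel_le hμ h hx (t := 2 * η) (by positivity)
  have hw : 2 * η * μ < μ := by nlinarith
  have hgi := integrableOn_exp_overshoot hμ h hx hw
  have hgeq : ∫ ω in exits s Y x, Real.exp (2 * η * μ * |overshoot s Y x ω|) ∂P =
    overshootMGF P s Y x (2 * η * μ) := rfl
  have hf2 : ∀ ω, exitWeight s Y x 1 (η * μ) 0 ω ^ 2 = exitWeight s Y x 1 (2 * η * μ) 0 ω := by
    intro ω
    simp only [exitWeight, one_pow, one_mul, ← Real.exp_nat_mul]
    push_cast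
    ring_nf
  have hg2 : ∀ ω ∈ exits s Y x, exitWeight s Y x 1 0 (η * μ) ω ^ 2 =
      Real.exp (2 * η * μ * |overshoot s Y x ω|) := by
    intro ω hω
    rw [exitWeight_one_eq_abs hx hω, ← Real.exp_nat_mul]
    push_cast
    ring_nf
  -- Only on the exit event is the overshoot known to equal its absolute value.
  have hg2' : (fun ω => Real.exp (2 * η * μ * |overshoot s Y x ω|)) =ᵐ[P.restrict (exits s Y x)]
      fun ω => exitWeight s Y x 1 0 (η * μ) ω ^ 2 := by
    filter_upwards [ae_restrict_mem (h.measurableSet_exits hx)] with ω hω using (hg2 ω hω).symm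
  have hfm : MemLp (exitWeight s Y x 1 (η * μ) 0) 2 (P.restrict (exits s Y x)) := by
    rw [memLp_two_iff_integrable_sq (h.aestronglyMeasurable_exitWeight hx _ _ _)]
    simp only [hf2]
    exact hfi
  have hgm : MemLp (exitWeight s Y x 1 0 (η * μ)) 2 (P.restrict (exits s Y x)) := by
    rw [memLp_two_iff_integrable_sq (h.aestronglyMeasurable_exitWeight hx _ _ _)]
    exact hgi.congr hg2'
  have hcs := integral_mul_le_Lp_mul_Lq_of_nonneg (μ := P.restrict (exits s Y x))
    Real.HolderConjugate.two_two
    (ae_of_all _ (exitWeight_nonneg zero_le_one x (η * μ) 0))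
    (ae_of_all _ (exitWeight_nonneg zero_le_one x 0 (η * μ))) (by simpa using hfm)
    (by simpa using hgm)
  simp only [Real.rpow_two, ← Real.sqrt_eq_rpow, hf2] at hcs
  rw [← integral_congr_ae hg2', hgeq] at hcs
  have hm : 0 ≤ overshootMGF P s Y x (2 * η * μ) :=
    integral_nonneg fun _ => (Real.exp_pos _).le
  calc reflectedFrom P s Y (η * μ) x
      = ∫ ω in exits s Y x, exitWeight s Y x 1 (η * μ) 0 ω * exitWeight s Y x 1 0 (η * μ) ω ∂P := by
        rw [reflectedFrom_eq h hx]
        refine integral_congr_ae (ae_of_all _ fun ω => ?_)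
        simp only [exitWeight, one_pow, one_mul, ← Real.exp_add]
        ring_nf
    _ ≤ _ := hcs
    _ ≤ _ := by
        rw [Real.sqrt_mul' _ hm]
        gcongr

lemma sqrt_exitTimeGF_mul_overshootMGF (hμ : 0 < μ)
    (h : IsRenewalSteps P (1 / 2) (expMeasure μ) s Y) {η x : ℝ} (hη : 0 ≤ η) (hη1 : 2 * η < 1)
    (hx : 0 ≤ x) :
    Real.exp (-(η * μ) * x) * √(exitTimeGF P s Y x (laplace (expMeasure μ) (2 * η * μ)) *
        overshootMGF P s Y x (2 * η * μ)) =
      √(1 - √(2 * η / (1 + 2 * η))) * √(1 / (1 - 2 * η)) *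
        Real.exp (-(μ * (η + 1 / 2 * √(2 * η / (1 + 2 * η)))) * x) := by
  have hr := sqrt_div_one_add_lt_one (t := 2 * η) (by positivity)
  rw [exitTimeGF_eq hμ h hx (by positivity), overshootMGF_eq hμ h hx (by nlinarith)]
  set r := √(2 * η / (1 + 2 * η))
  -- The square root halves the rate `μ r`, which is the source of the `1/2` in the final
  -- denominator.
  have e : Real.exp (-(μ * r * x)) = Real.exp (-(μ * r / 2) * x) ^ 2 := by
    rw [← Real.exp_nat_mul]; push_cast; ring_nf
  have e' : μ / (μ - 2 * η * μ) = 1 / (1 - 2 * η) := by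
    rw [show μ - 2 * η * μ = μ * (1 - 2 * η) by ring, div_mul_eq_div_div, div_self hμ.ne']
  rw [e, e', show (1 - r) * Real.exp (-(μ * r / 2) * x) ^ 2 * (1 / (1 - 2 * η)) =
    ((1 - r) * (1 / (1 - 2 * η))) * Real.exp (-(μ * r / 2) * x) ^ 2 by ring,
    Real.sqrt_mul' _ (sq_nonneg _), Real.sqrt_sq (Real.exp_pos _).le,
    Real.sqrt_mul (by linarith), mul_left_comm, ← Real.exp_add]
  ring_nf

lemma integrable_upperBound (hμ : 0 < μ) (h : IsRenewalSteps P (1 / 2) (expMeasure μ) s Y)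
    {η : ℝ} (hη : 0 ≤ η) (hη1 : 2 * η < 1) :
    Integrable (fun x => Real.exp (-(η * μ) * x) *
      √(exitTimeGF P s Y x (laplace (expMeasure μ) (2 * η * μ)) *
        overshootMGF P s Y x (2 * η * μ))) (expMeasure μ) := by
  refine ((integrable_exp_neg_expMeasure (v := μ * (η + 1 / 2 * √(2 * η / (1 + 2 * η)))) hμ
    (by positivity)).const_mul (√(1 - √(2 * η / (1 + 2 * η))) * √(1 / (1 - 2 * η)))).congr ?_
  filter_upwards [ae_expMeasure_pos μ] with x hx
  exact (sqrt_exitTimeGF_mul_overshootMGF hμ h hη hη1 hx.le).symm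

lemma upperBound_eq (hμ : 0 < μ) (h : IsRenewalSteps P (1 / 2) (expMeasure μ) s Y)
    {η : ℝ} (hη : 0 ≤ η) (hη1 : 2 * η < 1) :
    upperBound P s Y (expMeasure μ) (expMeasure μ) (η * μ) =
      √(1 - √(2 * η / (1 + 2 * η))) * √(1 / (1 - 2 * η)) /
          (1 + η + 1 / 2 * √(2 * η / (1 + 2 * η))) := by
  have hl := laplace_expMeasure (v := μ * (η + 1 / 2 * √(2 * η / (1 + 2 * η)))) hμ (by positivity)
  rw [upperBound, ← mul_assoc, integral_congr_ae ((ae_expMeasure_pos μ).mono fun x hx =>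
    sqrt_exitTimeGF_mul_overshootMGF hμ h hη hη1 hx.le), integral_const_mul]
  rw [laplace] at hl
  rw [hl, show μ + μ * (η + 1 / 2 * √(2 * η / (1 + 2 * η))) =
    μ * (1 + η + 1 / 2 * √(2 * η / (1 + 2 * η))) by ring, div_mul_eq_div_div, div_self hμ.ne',
    mul_one_div]

lemma reflectedFraction_le_upperBound (hμ : 0 < μ)
    (h : IsRenewalSteps P (1 / 2) (expMeasure μ) s Y) {η : ℝ} (hη : 0 ≤ η) (hη1 : 2 * η < 1) :
    reflectedFraction P s Y (expMeasure μ) (η * μ) ≤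
      upperBound P s Y (expMeasure μ) (expMeasure μ) (η * μ) := by
  rw [upperBound, ← mul_assoc]
  refine integral_mono_ae (integrable_reflectedFrom hμ h (by positivity))
    (integrable_upperBound hμ h hη hη1) ?_
  filter_upwards [ae_expMeasure_pos μ] with x hx
  exact mul_le_mul_of_nonneg_left (reflectedFrom_le hμ h hη hη1 hx.le) (Real.exp_pos _).le

end Bound

end PorousMedium

end

theorem theorem2 {Ω : Type*} [MeasurableSpace Ω] (P : Measure Ω) [IsProbabilityMeasure P]
    (s Y : ℕ → Ω → ℝ) (μ β η : ℝ) (hμ : 0 < μ) (hβ : 0 ≤ β) (hη : η = β / μ)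
    (hsteps : PorousMedium.IsRenewalSteps P (1 / 2) (expMeasure μ) s Y) :
    -- the exit time is almost surely finite, and the reflected fraction is well defined
    (∀ x, 0 ≤ x → ∀ᵐ ω ∂P, ω ∈ PorousMedium.exits s Y x) ∧
    (∀ x, 0 ≤ x → IntegrableOn (fun ω => Real.exp
      (-β * PorousMedium.travel s Y x ω + β * |PorousMedium.overshoot s Y x ω|))
      (PorousMedium.exits s Y x) P) ∧
    Integrable (fun x => Real.exp (-β * x) * PorousMedium.reflectedFrom P s Y β x)
      (expMeasure μ) ∧
    -- the estimate for normal incidence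
    Tendsto (fun ε => PorousMedium.deltaEstimate P s Y (expMeasure μ) (expMeasure μ) β ε) (𝓝[>] 0)
      (𝓝 ((1 - √(2 * η / (2 * η + 1))) / (η + 1 + √(2 * η / (2 * η + 1))) * (1 + η))) ∧
    -- the estimate for incidence at angle `θ`
    (∀ θ, -(Real.pi / 2) < θ → θ < Real.pi / 2 →
      Tendsto (fun ε => PorousMedium.deltaEstimate P s Y (expMeasure μ)
          (PorousMedium.depthLaw (expMeasure μ) θ) β ε) (𝓝[>] 0)
        (𝓝 ((1 - √(2 * η / (1 + 2 * η))) *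
          (1 + (η + √(2 * η / (1 + 2 * η))) * Real.cos θ)⁻¹ * (1 + η)))) ∧
    -- the upper bound
    (2 * β < μ →
      (∀ x, 0 ≤ x → IntegrableOn (fun ω => Real.exp (2 * β * |PorousMedium.overshoot s Y x ω|))
        (PorousMedium.exits s Y x) P) ∧
      Integrable (fun x => Real.exp (-β * x) *
        √(PorousMedium.exitTimeGF P s Y x (PorousMedium.laplace (expMeasure μ) (2 * β)) *
          PorousMedium.overshootMGF P s Y x (2 * β))) (expMeasure μ) ∧
      PorousMedium.reflectedFraction P s Y (expMeasure μ) β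
        ≤ PorousMedium.upperBound P s Y (expMeasure μ) (expMeasure μ) β ∧
      PorousMedium.upperBound P s Y (expMeasure μ) (expMeasure μ) β =
        √(1 - √(2 * η / (1 + 2 * η))) * √(1 / (1 - 2 * η)) /
          (1 + η + 1 / 2 * √(2 * η / (1 + 2 * η)))) := by
  have hη0 : 0 ≤ η := hη ▸ div_nonneg hβ hμ.le
  obtain rfl : β = η * μ := by rw [hη, div_mul_cancel₀ _ hμ.ne']
  refine ⟨fun x hx => hsteps.ae_mem_exits hμ hx, fun x hx => ?_,
    PorousMedium.integrable_reflectedFrom hμ hsteps hβ, ?_, fun θ h1 h2 =>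
    PorousMedium.tendsto_deltaEstimate hμ hsteps hη0 (Real.cos_pos_of_mem_Ioo ⟨h1, h2⟩),
    fun hβμ => ?_⟩
  · obtain ⟨C, c, -, hC⟩ := PorousMedium.exists_reflectedFrom_eq hμ hsteps hβ
    exact (hC x hx).1.congr_fun
      (fun ω hω => PorousMedium.exitWeight_one_eq_abs hx hω _ _) (hsteps.measurableSet_exits hx)
  · have h := PorousMedium.tendsto_deltaEstimate (θ := 0) hμ hsteps hη0 (by simp)
    rw [PorousMedium.depthLaw_zero, Real.cos_zero, mul_one, ← div_eq_mul_inv, ← add_assoc,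
      add_comm 1 η, add_comm 1 (2 * η)] at h
    rwa [add_comm 1 η]
  · have hη1 : 2 * η < 1 := by
      refine lt_of_mul_lt_mul_right ?_ hμ.le
      linarith
    refine ⟨fun x hx => PorousMedium.integrableOn_exp_overshoot hμ hsteps hx hβμ, ?_,
      PorousMedium.reflectedFraction_le_upperBound hμ hsteps hη0 hη1,
      PorousMedium.upperBound_eq hμ hsteps hη0 hη1⟩
    rw [← mul_assoc]
    exact PorousMedium.integrable_upperBound hμ hsteps hη0 hη1
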